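/- Let $X$ be a $\sigma$-compact metrizable Suslin space (a continuous image of a Polish space) with no isolated points, and let $Y$ be a real Fréchet space, i.e. a locally convex real topological vector space whose topology is induced by a complete translation invariant metric. Assume that $Y$ is either compact, or $\sigma$-compact but not compact. For a function $f\colon X\to Y$ let $L_f\subseteq X\times Y$ denote the set of accumulation points in $X\times Y$ of its graph $\{(x,f(x)) : x\in X\}$. Call a function $X\to Y$ Baire-$0$ if it is continuous, and Baire-$(n+1)$ if it is the pointwise limit of a sequence of Baire-$n$ functions $X\to Y$. If a subset $T\subseteq X\times Y$ satisfies $T=L_f$ for some (arbitrary) function $f\colon X\to Y$, then there is a Baire-$2$ function $g\colon X\to Y$ with $T=L_g$. -/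

import Mathlib

open Set Filter Topology

/-- A (real) Fréchet space: a locally convex topological vector space whose topology is induced by
a complete translation invariant metric. -/
class IsFrechetSpace (Y : Type*) [AddCommGroup Y] [Module ℝ Y] [TopologicalSpace Y] : Prop
    extends IsTopologicalAddGroup Y, ContinuousSMul ℝ Y, LocallyConvexSpace ℝ Y where
  exists_metric : ∃ m : MetricSpace Y,
    m.toUniformSpace.toTopologicalSpace = ‹TopologicalSpace Y› ∧
    (∀ x y z : Y, m.dist (x + z) (y + z) = m.dist x y) ∧
    @CompleteSpace Y m.toUniformSpace

/-- The finite Baire classes: Baire-`0` functions are the continuous ones, and Baire-`(n + 1)`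
functions are the pointwise limits of sequences of Baire-`n` functions. -/
def IsBaireClass {X Y : Type*} [TopologicalSpace X] [TopologicalSpace Y] : ℕ → (X → Y) → Prop
  | 0, f => Continuous f
  | n + 1, f => ∃ F : ℕ → X → Y, (∀ k, IsBaireClass n (F k)) ∧
      ∀ x, Tendsto (fun k => F k x) atTop (𝓝 (f x))

/-- The set `L_f` of accumulation points, in `X × Y`, of the graph `{(x, f x) | x ∈ X}` of `f`. -/
def graphAccumulationSet {X Y : Type*} [TopologicalSpace X] [TopologicalSpace Y] (f : X → Y) :
    Set (X × Y) :=
  derivedSet (Set.univ.graphOn f)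

/-! Write `T = L_f`. Then `T` is closed, and the set `D` of points of `X` over which `T` has empty
fiber is countable, because over such an `x` the point `(x, f x)` is isolated in the graph. Define
`g` in three pieces. On a countable set `C`, `g` takes values whose graph points shadow a dense
sequence of `T`; this forces `T ⊆ L_g` and accumulates only on `T`. On `D \ C` the values escape to
infinity, so they accumulate nowhere; for compact `Y` the set `D` is empty. Elsewhere `g x` is
chosen in the fiber of `T`, which adds nothing outside the closed set `T`. The selection can be made
a pointwise limit of step functions with `Fσ` fibers. These are Baire-1 by Urysohn and the linear
structure of `Y`, and the countable set `C ∪ D` can be corrected finitely many points at a time, so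
`g` is Baire-2. -/

/-- A function with countable range all of whose fibers are `Fσ` sets. -/
def IsFsigmaStep {X Z : Type*} [TopologicalSpace X] (h : X → Z) : Prop :=
  (range h).Countable ∧ ∀ z, IsGδ (h ⁻¹' {z})ᶜ

lemma IsFsigmaStep.isGδ_compl_preimage {X Z : Type*} [TopologicalSpace X] {h : X → Z}
    (hh : IsFsigmaStep h) (s : Set Z) : IsGδ (h ⁻¹' s)ᶜ := by
  have : (h ⁻¹' s)ᶜ = ⋂ z ∈ s ∩ range h, (h ⁻¹' {z})ᶜ := by
    ext x
    simp only [mem_compl_iff, mem_preimage, mem_iInter, mem_singleton_iff]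
    exact ⟨fun hx z hz e => hx (e ▸ hz.1), fun H hx => H _ ⟨hx, mem_range_self x⟩ rfl⟩
  rw [this]
  exact IsGδ.biInter (hh.1.mono inter_subset_right) fun z _ => hh.2 z

lemma IsFsigmaStep.comp {X Z W : Type*} [TopologicalSpace X] {h : X → Z}
    (hh : IsFsigmaStep h) (w : Z → W) : IsFsigmaStep (w ∘ h) :=
  ⟨by rw [range_comp]; exact hh.1.image w, fun z => hh.isGδ_compl_preimage (w ⁻¹' {z})⟩

lemma IsFsigmaStep.modify_finite {X Z : Type*} [TopologicalSpace X] [T1Space X]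
    [FirstCountableTopology X] {h g h' : X → Z} (hh : IsFsigmaStep h) {F : Set X} (hF : F.Finite)
    (hg : ∀ x ∈ F, h' x = g x) (hh' : ∀ x ∉ F, h' x = h x) : IsFsigmaStep h' := by
  refine ⟨(hh.1.union (hF.image g).countable).mono ?_, fun z => ?_⟩
  · rintro _ ⟨x, rfl⟩
    by_cases hx : x ∈ F
    · exact Or.inr ⟨x, hx, (hg x hx).symm⟩
    · exact Or.inl ⟨x, (hh' x hx).symm⟩
  · have : (h' ⁻¹' {z})ᶜ = ((h ⁻¹' {z})ᶜ ∪ F) ∩ (F ∩ g ⁻¹' {z})ᶜ := by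
      ext x
      by_cases hx : x ∈ F
      · simp [hx, hg x hx]
      · simp [hx, hh' x hx]
    rw [this]
    exact ((hh.2 z).union hF.isGδ).inter
      ((hF.subset inter_subset_left).isClosed.isOpen_compl.isGδ)

lemma exists_monotone_isClosed_iUnion_eq {X : Type*} [TopologicalSpace X] {s : Set X}
    (hs : IsGδ sᶜ) : ∃ C : ℕ → Set X, (∀ n, IsClosed (C n)) ∧ Monotone C ∧ ⋃ n, C n = s := by
  obtain ⟨f, hf, hsf⟩ := isGδ_iff_eq_iInter_nat.1 hs
  refine ⟨fun n => ⋃ i ∈ Finset.range n, (f i)ᶜ, fun n => ?_, fun m n hmn => ?_, ?_⟩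
  · exact isClosed_biUnion_finset fun i _ => (hf i).isClosed_compl
  · refine biUnion_subset_biUnion_left fun i hi => ?_
    simp only [Finset.coe_range, mem_Iio] at hi ⊢
    exact lt_of_lt_of_le hi hmn
  · rw [← compl_compl s, hsf, compl_iInter]
    ext x
    simp only [mem_iUnion, Finset.mem_range]
    exact ⟨fun ⟨n, i, _, h⟩ => ⟨i, h⟩, fun ⟨i, h⟩ => ⟨i + 1, i, Nat.lt_succ_self i, h⟩⟩

/-- Exhaust each fiber by increasing closed sets. At stage `m` only the first `m` values count;
their closed pieces are disjoint, so Urysohn functions separate them, and the combination `∑ φ y •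
y` equals `h x` once `m` is large. -/
lemma IsFsigmaStep.isBaireClass_one {X Y : Type*} [TopologicalSpace X] [NormalSpace X]
    [AddCommGroup Y] [Module ℝ Y] [TopologicalSpace Y] [ContinuousAdd Y] [ContinuousSMul ℝ Y]
    {h : X → Y} (hh : IsFsigmaStep h) : IsBaireClass 1 h := by
  classical
  rcases isEmpty_or_nonempty X with hX | hX
  · exact ⟨fun _ => h, fun _ => continuous_of_const fun x => hX.elim x, fun x => hX.elim x⟩
  obtain ⟨u, hu⟩ := hh.1.exists_eq_range (range_nonempty h)
  choose C hCc hCm hCU using fun y => exists_monotone_isClosed_iUnion_eq (hh.2 y)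
  have hCh : ∀ {y m x}, x ∈ C y m → h x = y := fun {y m x} hx => by
    have : x ∈ ⋃ n, C y n := mem_iUnion.2 ⟨m, hx⟩
    rwa [hCU] at this
  let F : ℕ → Finset Y := fun m => (Finset.range m).image u
  have hφ : ∀ y m, ∃ φ : C(X, ℝ), EqOn φ 0 (⋃ y' ∈ (F m).erase y, C y' m) ∧
      EqOn φ 1 (C y m) := fun y m => by
    obtain ⟨φ, h0, h1, _⟩ := exists_continuous_zero_one_of_isClosed
      (s := ⋃ y' ∈ (F m).erase y, C y' m) (t := C y m)
      (isClosed_biUnion_finset fun y' _ => hCc y' m) (hCc y m) (by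
        rw [Set.disjoint_left]
        intro x hx hx'
        simp only [mem_iUnion] at hx
        obtain ⟨y', hy', hx⟩ := hx
        exact (Finset.mem_erase.1 hy').1 ((hCh hx).symm.trans (hCh hx')))
    exact ⟨φ, h0, h1⟩
  choose φ hφ0 hφ1 using hφ
  refine ⟨fun m x => ∑ y ∈ F m, φ y m x • y, fun m => ?_, fun x => ?_⟩
  · exact continuous_finsetSum _ fun y _ => (φ y m).continuous.smul continuous_const
  · obtain ⟨i, hi⟩ : h x ∈ range u := hu ▸ mem_range_self x
    obtain ⟨M, hM⟩ : ∃ M, x ∈ C (h x) M := by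
      have : x ∈ ⋃ n, C (h x) n := by rw [hCU]; rfl
      exact mem_iUnion.1 this
    refine tendsto_const_nhds.congr' ?_
    filter_upwards [eventually_ge_atTop M, eventually_gt_atTop i] with m hm him
    have hxm : x ∈ C (h x) m := hCm _ hm hM
    have hmem : h x ∈ F m := Finset.mem_image.2 ⟨i, Finset.mem_range.2 him, hi⟩
    rw [Finset.sum_eq_single_of_mem (h x) hmem, hφ1 _ _ hxm, Pi.one_apply, one_smul]
    intro y _ hyx
    rw [hφ0 y m (mem_iUnion₂.2 ⟨h x, Finset.mem_erase.2 ⟨hyx.symm, hmem⟩, hxm⟩), Pi.zero_apply,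
      zero_smul]

lemma isBaireClass_two_of_tendsto_off_countable {X Y : Type*} [TopologicalSpace X] [T4Space X]
    [FirstCountableTopology X]
    [AddCommGroup Y] [Module ℝ Y] [TopologicalSpace Y] [ContinuousAdd Y] [ContinuousSMul ℝ Y]
    {g : X → Y} {G : ℕ → X → Y} (hG : ∀ k, IsFsigmaStep (G k)) {C : Set X} (hC : C.Countable)
    (hlim : ∀ x ∉ C, Tendsto (fun k => G k x) atTop (𝓝 (g x))) : IsBaireClass 2 g := by
  classical
  obtain ⟨idx, hidx⟩ := countable_iff_exists_injOn.1 hC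
  have hfin : ∀ k, {x ∈ C | idx x < k}.Finite := fun k =>
    Finite.of_finite_image ((finite_Iio k).subset (by rintro _ ⟨x, hx, rfl⟩; exact hx.2))
      (hidx.mono fun x hx => hx.1)
  -- Stage `k` installs the correct value only at points of `C` of index below `k`, a finite set.
  refine ⟨fun k x => if x ∈ C ∧ idx x < k then g x else G k x, fun k => ?_, fun x => ?_⟩
  · exact ((hG k).modify_finite (g := g) (hfin k) (fun x hx => if_pos hx)
      (fun x hx => if_neg hx)).isBaireClass_one
  · by_cases hx : x ∈ C
    · refine tendsto_const_nhds.congr' ?_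
      filter_upwards [eventually_gt_atTop (idx x)] with k hk
      rw [if_pos ⟨hx, hk⟩]
    · simpa [hx] using hlim x hx

/-! ### Selections from closed sets -/

/-- A `σ`-compact metric space is a countable union of compact sets of small diameter. -/
lemma exists_compact_cover_dist_le {Y : Type*} [MetricSpace Y] [SigmaCompactSpace Y] {ε : ℝ}
    (hε : 0 < ε) : ∃ V : ℕ → Set Y, (∀ i, IsCompact (V i)) ∧
      (∀ i, ∀ a ∈ V i, ∀ b ∈ V i, dist a b ≤ ε) ∧ ⋃ i, V i = univ := by
  rcases isEmpty_or_nonempty Y with hY | hY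
  · exact ⟨fun _ => ∅, fun _ => isCompact_empty, by simp, Subsingleton.elim _ _⟩
  let u := TopologicalSpace.denseSeq Y
  refine ⟨fun n => compactCovering Y n.unpair.1 ∩ Metric.closedBall (u n.unpair.2) (ε / 2),
    fun n => (isCompact_compactCovering Y _).inter_right Metric.isClosed_closedBall,
    fun n a ha b hb => ?_, eq_univ_of_forall fun y => ?_⟩
  · calc dist a b ≤ dist a (u n.unpair.2) + dist b (u n.unpair.2) := dist_triangle_right _ _ _
      _ ≤ ε / 2 + ε / 2 := add_le_add ha.2 hb.2
      _ = ε := by ring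
  · obtain ⟨i, hi⟩ := exists_mem_compactCovering y
    obtain ⟨j, hj⟩ := (TopologicalSpace.denseRange_denseSeq Y).exists_dist_lt y (half_pos hε)
    refine mem_iUnion.2 ⟨Nat.pair i j, ?_⟩
    rw [Nat.unpair_pair]
    exact ⟨hi, hj.le⟩

lemma isClosed_setOf_exists_mem_compact {X Y : Type*} [TopologicalSpace X] [TopologicalSpace Y]
    {T : Set (X × Y)} (hT : IsClosed T) {K : Set Y} (hK : IsCompact K) :
    IsClosed {x | ∃ y ∈ K, (x, y) ∈ T} := by
  have := isCompact_iff_compactSpace.1 hK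
  have h : IsClosed ((fun p : X × K => (p.1, (p.2 : Y))) ⁻¹' T) :=
    hT.preimage (by fun_prop)
  convert isClosedMap_fst_of_compactSpace _ h using 1
  ext x
  simp

/-- A closed subset of `X × Y` has, off the set of points with empty fibers, a selection which is
the pointwise limit of step functions with `Fσ` fibers. -/
lemma exists_isFsigmaStep_tendsto_selection {X Y : Type*} [MetricSpace X] [MetricSpace Y]
    [SigmaCompactSpace Y] [Nonempty Y] {T : Set (X × Y)} (hT : IsClosed T)
    (hD : {x | ∀ y, (x, y) ∉ T}.Countable) :
    ∃ G : ℕ → X → Y, (∀ k, IsFsigmaStep (G k)) ∧ ∀ x, (∃ y, (x, y) ∈ T) →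
      ∃ y, (x, y) ∈ T ∧ Tendsto (fun k => G k x) atTop (𝓝 y) := by
  classical
  choose V hVc hVd hVU using fun k : ℕ =>
    exists_compact_cover_dist_le (Y := Y) (Nat.one_div_pos_of_nat (α := ℝ) (n := k))
  -- Lists grow at the head: the entry added to `s` picks a piece of the cover of mesh `1 /
  -- (s.length + 1)`.
  let W : List ℕ → Set Y := fun l => l.rec univ fun i s w => w ∩ V s.length i
  have hWcons : ∀ i s, W (i :: s) = W s ∩ V s.length i := fun _ _ => rfl
  let P : List ℕ → Set X := fun l => {x | ∃ y ∈ W l, (x, y) ∈ T}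
  have hWcl : ∀ l, IsClosed (W l) := fun l => by
    induction l with
    | nil => exact isClosed_univ
    | cons i s ih => exact ih.inter (hVc _ _).isClosed
  have hWco : ∀ i s, IsCompact (W (i :: s)) := fun i s => (hVc _ _).inter_left (hWcl s)
  have hPcl : ∀ i s, IsClosed (P (i :: s)) := fun i s =>
    isClosed_setOf_exists_mem_compact hT (hWco i s)
  -- Greedy choice: the least index whose piece still meets the fiber of `T` over `x`.
  let S : ℕ → X → List ℕ := fun k x =>
    k.rec [] fun _ s => sInf {i | x ∈ P (i :: s)} :: s
  have hS : ∀ k x, S (k + 1) x = sInf {i | x ∈ P (i :: S k x)} :: S k x := fun _ _ => rfl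
  have hlen : ∀ k x, (S k x).length = k := fun k x => by
    induction k with
    | zero => rfl
    | succ k ih => rw [hS, List.length_cons, ih]
  have hne : ∀ k x, x ∈ P (S k x) → {i | x ∈ P (i :: S k x)}.Nonempty := by
    rintro k x ⟨y, hy, hxy⟩
    have : y ∈ ⋃ i, V (S k x).length i := by rw [hVU]; trivial
    obtain ⟨i, hi⟩ := mem_iUnion.1 this
    exact ⟨i, y, ⟨hy, hi⟩, hxy⟩
  have hP : ∀ k x, (∃ y, (x, y) ∈ T) → x ∈ P (S k x) := by
    rintro k x ⟨y, hy⟩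
    induction k with
    | zero => exact ⟨y, trivial, hy⟩
    | succ k ih => rw [hS]; exact Nat.sInf_mem (hne k x ih)
  have hstep : ∀ k, IsFsigmaStep (S k) := fun k => by
    induction k with
    | zero =>
      refine ⟨to_countable _, fun z => ?_⟩
      change IsGδ {x : X | ([] : List ℕ) ∈ ({z} : Set (List ℕ))}ᶜ
      by_cases hz : ([] : List ℕ) ∈ ({z} : Set (List ℕ)) <;> simp [hz]
    | succ k ih =>
      refine ⟨to_countable _, fun z => ?_⟩
      cases z with
      | nil =>
        convert IsGδ.univ using 1
        ext x
        simp [hS]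
      | cons i s =>
        -- Over empty fibers `sInf ∅ = 0` gives junk indices; the last factor accounts for those
        -- countably many points.
        have : (S (k + 1) ⁻¹' {i :: s})ᶜ =
            ((S k ⁻¹' {s})ᶜ ∪ (P (i :: s))ᶜ ∪ ⋃ j ∈ Finset.range i, P (j :: s)) ∩
              ({x | ∀ y, (x, y) ∉ T} ∩ S (k + 1) ⁻¹' {i :: s})ᶜ := by
          rw [← compl_inj_iff]
          simp only [compl_inter, compl_union, compl_compl]
          ext x
          simp only [mem_preimage, mem_singleton_iff, mem_union, mem_inter_iff, mem_compl_iff,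
            mem_iUnion, Finset.mem_range, not_exists, mem_ofPred_eq]
          constructor
          · intro hx
            by_cases hxT : ∃ y, (x, y) ∈ T
            · left
              have hxP := Nat.sInf_mem (hne k x (hP k x hxT))
              rw [hS, List.cons.injEq] at hx
              obtain ⟨h1, rfl⟩ := hx
              rw [h1] at hxP
              exact ⟨⟨rfl, hxP⟩, fun j hj hxj => Nat.notMem_of_lt_sInf (h1 ▸ hj) hxj⟩
            · right
              exact ⟨not_exists.1 hxT, hx⟩
          · rintro (⟨⟨rfl, h1⟩, h2⟩ | ⟨_, h⟩)
            · rw [hS, List.cons.injEq]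
              refine ⟨le_antisymm (Nat.sInf_le h1) (not_lt.1 fun h => h2 _ h ?_), rfl⟩
              exact Nat.sInf_mem (s := {i | x ∈ P (i :: S k x)}) ⟨i, h1⟩
            · exact h
        rw [this]
        refine (((ih.2 s).union (hPcl i s).isOpen_compl.isGδ).union ?_).inter
          (hD.mono inter_subset_left).isGδ_compl
        exact (isClosed_biUnion_finset fun j _ => hPcl j s).isGδ
  let w : List ℕ → Y := fun l => if h : (W l).Nonempty then h.some else Classical.arbitrary Y
  have hw : ∀ l, (W l).Nonempty → w l ∈ W l := fun l h => by
    simp only [w, dif_pos h]; exact h.some_mem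
  refine ⟨fun k => w ∘ S k, fun k => (hstep k).comp w, fun x hx => ?_⟩
  have hTx : IsClosed {y | (x, y) ∈ T} := hT.preimage (by fun_prop : Continuous fun y => (x, y))
  -- Cantor intersection, started at level one since `W [] = univ` need not be compact.
  obtain ⟨y, hy⟩ : (⋂ k, W (S (k + 1) x) ∩ {y | (x, y) ∈ T}).Nonempty := by
    have hco : IsCompact (W (S 1 x)) := hWco _ (S 0 x)
    refine IsCompact.nonempty_iInter_of_sequence_nonempty_isCompact_isClosed _ (fun k => ?_)
      (fun k => ?_) (hco.inter_right hTx) fun k => (hWcl (S (k + 1) x)).inter hTx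
    · refine inter_subset_inter_left _ ?_
      rw [hS (k + 1)]
      exact inter_subset_left
    · obtain ⟨y, hy, hxy⟩ := hP (k + 1) x hx
      exact ⟨y, hy, hxy⟩
  rw [mem_iInter] at hy
  refine ⟨y, (hy 0).2, (tendsto_add_atTop_iff_nat 1).1 ?_⟩
  rw [tendsto_iff_dist_tendsto_zero]
  refine squeeze_zero (fun _ => dist_nonneg) (fun k => ?_)
    (tendsto_one_div_add_atTop_nhds_zero_nat (𝕜 := ℝ))
  have h1 := hw (S (k + 1) x) ⟨y, (hy k).1⟩
  have h2 := (hy k).1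
  rw [hS, hWcons, hlen] at h1 h2
  exact hVd k _ _ h1.2 _ h2.2

/-! ### Accumulation points of graphs -/

lemma mem_graphAccumulationSet_iff {X Y : Type*} [TopologicalSpace X] [TopologicalSpace Y]
    [T1Space X] [T1Space Y] {f : X → Y} {p : X × Y} :
    p ∈ graphAccumulationSet f ↔ ∀ U ∈ 𝓝 p, ∃ z, z ≠ p.1 ∧ (z, f z) ∈ U := by
  rw [graphAccumulationSet, mem_derivedSet, accPt_iff_nhds]
  constructor
  · intro h U hU
    by_cases hp : p = (p.1, f p.1)
    · obtain ⟨_, ⟨hyU, z, _, rfl⟩, hne⟩ := h U hU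
      refine ⟨z, fun hz => hne ?_, hyU⟩
      rw [hz]; exact hp.symm
    · obtain ⟨_, ⟨hyU, z, _, rfl⟩, hne⟩ :=
        h (U ∩ {(p.1, f p.1)}ᶜ) (inter_mem hU (isOpen_compl_singleton.mem_nhds hp))
      refine ⟨z, fun hz => hyU.2 ?_, hyU.1⟩
      rw [hz]; rfl
  · intro h U hU
    obtain ⟨z, hz, hzU⟩ := h U hU
    exact ⟨(z, f z), ⟨hzU, z, trivial, rfl⟩, fun e => hz (congrArg Prod.fst e)⟩

lemma isClosed_graphAccumulationSet {X Y : Type*} [TopologicalSpace X] [TopologicalSpace Y]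
    [T1Space X] [T1Space Y] (f : X → Y) : IsClosed (graphAccumulationSet f) :=
  isClosed_derivedSet _

lemma graphAccumulationSet_subset {X Y : Type*} [TopologicalSpace X] [TopologicalSpace Y]
    [T1Space X] [T1Space Y] {f : X → Y} {T : Set (X × Y)}
    (h : ∀ p ∉ T, ∃ U ∈ 𝓝 p, {z | (z, f z) ∈ U}.Finite) : graphAccumulationSet f ⊆ T := by
  intro p hp
  by_contra hpT
  obtain ⟨U, hU, hfin⟩ := h p hpT
  refine Set.Infinite.of_accPt (AccPt.nhds_inter hp hU)
    ((hfin.image fun z => (z, f z)).subset ?_)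
  rintro _ ⟨hq, z, _, rfl⟩
  exact ⟨z, hq, rfl⟩

/-- The isolated points of a subset of a second countable space form a countable set. -/
lemma countable_sdiff_derivedSet {Z : Type*} [TopologicalSpace Z] [SecondCountableTopology Z]
    (E : Set Z) : (E \ derivedSet E).Countable := by
  have : DiscreteTopology ↥(E \ derivedSet E) := discreteTopology_of_noAccPts fun x hx h =>
    hx.2 (h.mono (principal_mono.2 sdiff_subset))
  exact countable_coe_iff.1 (TopologicalSpace.separableSpace_iff_countable.1 inferInstance)

lemma countable_setOf_forall_notMem_graphAccumulationSet {X Y : Type*} [TopologicalSpace X]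
    [TopologicalSpace Y] [SecondCountableTopology X] [SecondCountableTopology Y] (f : X → Y) :
    {x | ∀ y, (x, y) ∉ graphAccumulationSet f}.Countable := by
  refine ((countable_sdiff_derivedSet (univ.graphOn f)).image Prod.fst).mono fun x hx => ?_
  exact ⟨(x, f x), ⟨⟨x, trivial, rfl⟩, hx _⟩, rfl⟩

/-- By compactness `f` has a cluster value along the punctured neighborhoods of `x`. -/
lemma exists_mem_graphAccumulationSet_of_compactSpace {X Y : Type*} [TopologicalSpace X]
    [TopologicalSpace Y] [T1Space X] [T1Space Y] [CompactSpace Y] (f : X → Y) (x : X)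
    [NeBot (𝓝[≠] x)] : ∃ y, (x, y) ∈ graphAccumulationSet f := by
  obtain ⟨y, hy⟩ := exists_clusterPt_of_compactSpace (map f (𝓝[≠] x))
  refine ⟨y, mem_graphAccumulationSet_iff.2 fun U hU => ?_⟩
  obtain ⟨A, hA, B, hB, hAB⟩ := mem_nhds_prod_iff.1 hU
  obtain ⟨_, hzB, z, ⟨hzA, hzx⟩, rfl⟩ := clusterPt_iff_nonempty.1 hy hB
    (image_mem_map (inter_mem_nhdsWithin _ hA) : f '' ({x}ᶜ ∩ A) ∈ map f (𝓝[≠] x))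
  exact ⟨z, hzA, hAB ⟨hzx, hzB⟩⟩

/-- A noncompact metrizable space contains a sequence escaping to infinity. -/
lemma exists_seq_finite_preimage_of_not_compactSpace {Y : Type*} [MetricSpace Y]
    (hY : ¬ CompactSpace Y) : ∃ e : ℕ → Y, ∀ y, ∃ U ∈ 𝓝 y, {n | e n ∈ U}.Finite := by
  rw [compactSpace_iff_seqCompactSpace, seqCompactSpace_iff, IsSeqCompact] at hY
  push Not at hY
  obtain ⟨e, -, he⟩ := hY
  refine ⟨e, fun y => ?_⟩
  by_contra! h
  have hc : MapClusterPt y atTop e := mapClusterPt_iff_frequently.2 fun U hU =>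
    Nat.frequently_atTop_iff_infinite.2 (h U hU)
  obtain ⟨φ, hφ, hlim⟩ := hc.tendsto_subseq
  exact he y trivial φ hφ hlim

/-- Distinct representatives for a sequence of infinite sets. -/
lemma exists_injective_forall_mem_of_infinite {X : Type*} {Q : ℕ → Set X}
    (hQ : ∀ n, (Q n).Infinite) : ∃ u : ℕ → X, Function.Injective u ∧ ∀ n, u n ∈ Q n := by
  classical
  choose pick hpick hpick' using fun n (s : Finset X) => (hQ n).exists_notMem_finset s
  let F : ℕ → Finset X := fun n => n.rec ∅ fun n s => insert (pick n s) s
  have hF : ∀ n, F (n + 1) = insert (pick n (F n)) (F n) := fun _ => rfl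
  have hmono : Monotone F := monotone_nat_of_le_succ fun n => by
    rw [hF]; exact Finset.subset_insert _ _
  have hne : ∀ m n, m < n → pick m (F m) ≠ pick n (F n) := fun m n hmn h => by
    refine hpick' n (F n) (h ▸ hmono (Nat.succ_le_of_lt hmn) ?_)
    rw [hF]
    exact Finset.mem_insert_self _ _
  refine ⟨fun n => pick n (F n), fun m n h => ?_, fun n => hpick n _⟩
  rcases lt_trichotomy m n with hmn | hmn | hmn
  · exact absurd h (hne m n hmn)
  · exact hmn
  · exact absurd h.symm (hne n m hmn)

/-- If the domain has no isolated points, every closed subset of `X × Y` is the set of accumulation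
points of the graph of a function defined on a countable set. -/
lemma exists_countable_approximation {X Y : Type*} [MetricSpace X] [MetricSpace Y]
    [SecondCountableTopology X] [SecondCountableTopology Y] [∀ x : X, NeBot (𝓝[≠] x)]
    [Nonempty Y] {T : Set (X × Y)} (hT : IsClosed T) :
    ∃ (C : Set X) (b : X → Y), C.Countable ∧
      (∀ g : X → Y, EqOn g b C → T ⊆ graphAccumulationSet g) ∧
      ∀ p ∉ T, ∃ U ∈ 𝓝 p, {z ∈ C | (z, b z) ∈ U}.Finite := by
  rcases T.eq_empty_or_nonempty with rfl | hne
  · exact ⟨∅, fun _ => Classical.arbitrary Y, countable_empty, fun _ _ => empty_subset _,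
      fun p _ => ⟨univ, univ_mem, by simp⟩⟩
  have := hne.to_subtype
  let q : ℕ → X × Y := fun n => (TopologicalSpace.denseSeq T n : X × Y)
  have hq : ∀ n, q n ∈ T := fun n => (TopologicalSpace.denseSeq T n).2
  -- Each index is `n.unpair.1` for infinitely many `n`, so every `q j` is approached by infinitely
  -- many distinct `u n`.
  obtain ⟨u, hu, hub⟩ := exists_injective_forall_mem_of_infinite fun n : ℕ =>
    infinite_of_mem_nhds _ (Metric.ball_mem_nhds (q n.unpair.1).1
      (Nat.one_div_pos_of_nat (α := ℝ) (n := n)))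
  have hbu : ∀ n, Function.extend u (fun n => (q n.unpair.1).2)
      (fun _ => Classical.arbitrary Y) (u n) = (q n.unpair.1).2 := fun n => hu.extend_apply _ _ n
  have hdist : ∀ n, dist (u n, (q n.unpair.1).2) (q n.unpair.1) < 1 / ((n : ℝ) + 1) := fun n => by
    rw [Prod.dist_eq, dist_self]
    exact max_lt (hub n) Nat.one_div_pos_of_nat
  refine ⟨range u, Function.extend u (fun n => (q n.unpair.1).2) fun _ => Classical.arbitrary Y,
    countable_range u, fun g hg => ?_, fun p hp => ?_⟩
  · have hqg : ∀ n, q n ∈ graphAccumulationSet g := fun n => by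
      refine mem_graphAccumulationSet_iff.2 fun U hU => ?_
      obtain ⟨ε, hε, hεU⟩ := Metric.mem_nhds_iff.1 hU
      obtain ⟨N, hN⟩ := exists_nat_one_div_lt hε
      have key : ∀ m ≥ N, (u (Nat.pair n m), g (u (Nat.pair n m))) ∈ U := fun m hm => by
        refine hεU ?_
        rw [hg (mem_range_self _), hbu, Metric.mem_ball]
        have h := hdist (Nat.pair n m)
        rw [Nat.unpair_pair] at h ⊢
        refine h.trans (lt_of_le_of_lt (one_div_le_one_div_of_le (by positivity) ?_) hN)
        have : (N : ℝ) ≤ Nat.pair n m := by exact_mod_cast hm.trans (Nat.right_le_pair n m)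
        linarith
      -- By injectivity at most one `u` equals `(q n).1`; if it is this one, the next index serves.
      by_cases h : u (Nat.pair n N) = (q n).1
      · refine ⟨_, fun h' => ?_, key (N + 1) (Nat.le_succ N)⟩
        have := (Nat.pair_eq_pair.1 (hu (h'.trans h.symm))).2
        omega
      · exact ⟨_, h, key N le_rfl⟩
    intro p hp
    refine (isClosed_graphAccumulationSet g).closure_subset_iff.2 (range_subset_iff.2 hqg) ?_
    have h := closure_subtype.1 (TopologicalSpace.denseRange_denseSeq T ⟨p, hp⟩)
    rwa [← range_comp] at h
  · obtain ⟨ε, hε, hεT⟩ := Metric.mem_nhds_iff.1 (hT.isOpen_compl.mem_nhds hp)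
    obtain ⟨N, hN⟩ := exists_nat_one_div_lt (half_pos hε)
    refine ⟨Metric.ball p (ε / 2), Metric.ball_mem_nhds _ (half_pos hε),
      ((finite_Iio N).image u).subset ?_⟩
    rintro _ ⟨⟨n, rfl⟩, hn⟩
    refine ⟨n, mem_Iio.2 <| not_le.1 fun hNn => hεT (Metric.mem_ball.2 ?_) (hq n.unpair.1), rfl⟩
    rw [hbu, Metric.mem_ball] at hn
    have h1 := hdist n
    have h2 : 1 / ((n : ℝ) + 1) ≤ 1 / ((N : ℝ) + 1) := by
      refine one_div_le_one_div_of_le (by positivity) ?_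
      have : (N : ℝ) ≤ n := by exact_mod_cast hNn
      linarith
    have h3 := dist_triangle_left (q n.unpair.1) p (u n, (q n.unpair.1).2)
    linarith

lemma IsFrechetSpace.metrizableSpace {Y : Type*} [AddCommGroup Y] [Module ℝ Y]
    [TopologicalSpace Y] [IsFrechetSpace Y] : TopologicalSpace.MetrizableSpace Y := by
  obtain ⟨m, hm, -⟩ := IsFrechetSpace.exists_metric (Y := Y)
  rw [← hm]
  infer_instance

theorem corollary5p2 {X Y : Type*}
    [TopologicalSpace X] [TopologicalSpace.MetrizableSpace X] [SigmaCompactSpace X]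
    (hX_suslin : MeasureTheory.AnalyticSet (Set.univ : Set X))
    (hX_noIsolated : ∀ x : X, ¬ IsOpen ({x} : Set X))
    [AddCommGroup Y] [Module ℝ Y] [TopologicalSpace Y] [IsFrechetSpace Y]
    (hY : CompactSpace Y ∨ (SigmaCompactSpace Y ∧ ¬ CompactSpace Y))
    (T : Set (X × Y)) (hT : ∃ f : X → Y, T = graphAccumulationSet f) :
    ∃ g : X → Y, IsBaireClass 2 g ∧ T = graphAccumulationSet g := by
  classical
  obtain ⟨f, rfl⟩ := hT
  have : TopologicalSpace.MetrizableSpace Y := IsFrechetSpace.metrizableSpace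
  let _ := TopologicalSpace.metrizableSpaceMetric X
  let _ := TopologicalSpace.metrizableSpaceMetric Y
  have : SigmaCompactSpace Y := hY.elim (fun _ => inferInstance) And.left
  have : SecondCountableTopology X := UniformSpace.secondCountable_of_separable X
  have : SecondCountableTopology Y := UniformSpace.secondCountable_of_separable Y
  have : ∀ x : X, NeBot (𝓝[≠] x) := fun x =>
    ⟨fun h => hX_noIsolated x ((isOpen_singleton_iff_punctured_nhds x).2 h)⟩
  have hTc := isClosed_graphAccumulationSet f
  have hD := countable_setOf_forall_notMem_graphAccumulationSet f
  obtain ⟨C, b, hC, hCg, hCfin⟩ := exists_countable_approximation hTc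
  obtain ⟨G, hG, hGlim⟩ := exists_isFsigmaStep_tendsto_selection hTc hD
  obtain ⟨e, he⟩ : ∃ e : X → Y, ∀ p : X × Y, ∃ U ∈ 𝓝 p,
      {z | (∀ y, (z, y) ∉ graphAccumulationSet f) ∧ (z, e z) ∈ U}.Finite := by
    rcases hY with hY | ⟨-, hY⟩
    · refine ⟨f, fun p => ⟨univ, univ_mem, ?_⟩⟩
      convert finite_empty
      refine eq_empty_of_forall_notMem fun z hz => ?_
      obtain ⟨y, hy⟩ := exists_mem_graphAccumulationSet_of_compactSpace f z
      exact hz.1 y hy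
    · obtain ⟨s, hs⟩ := exists_seq_finite_preimage_of_not_compactSpace hY
      obtain ⟨idx, hidx⟩ := countable_iff_exists_injOn.1 hD
      refine ⟨s ∘ idx, fun p => ?_⟩
      obtain ⟨U, hU, hfin⟩ := hs p.2
      refine ⟨Prod.snd ⁻¹' U, continuous_snd.continuousAt hU, ?_⟩
      exact Finite.of_finite_image (hfin.subset (by rintro _ ⟨z, hz, rfl⟩; exact hz.2))
        (hidx.mono fun z hz => hz.1)
  choose! σ hσT hσlim using hGlim
  let g : X → Y := fun x =>
    if x ∈ C then b x else if ∀ y, (x, y) ∉ graphAccumulationSet f then e x else σ x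
  refine ⟨g, isBaireClass_two_of_tendsto_off_countable hG (hC.union hD) fun x hx => ?_,
    Subset.antisymm (hCg g fun x hx => if_pos hx) (graphAccumulationSet_subset fun p hp => ?_)⟩
  · rw [mem_union, not_or] at hx
    have hx2 : ¬ ∀ y, (x, y) ∉ graphAccumulationSet f := hx.2
    simp only [g, if_neg hx.1, if_neg hx2]
    exact hσlim x (by simpa using hx2)
  · obtain ⟨U₁, hU₁, h₁⟩ := hCfin p hp
    obtain ⟨U₂, hU₂, h₂⟩ := he p
    -- The three factors control the graph over `C`, over `D`, and over the remaining points, where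
    -- it lies in `T`.
    refine ⟨U₁ ∩ U₂ ∩ (graphAccumulationSet f)ᶜ,
      inter_mem (inter_mem hU₁ hU₂) (hTc.isOpen_compl.mem_nhds hp), (h₁.union h₂).subset ?_⟩
    rintro z ⟨⟨hz₁, hz₂⟩, hz₃⟩
    by_cases hzC : z ∈ C
    · simp only [g, if_pos hzC] at hz₁
      exact Or.inl ⟨hzC, hz₁⟩
    by_cases hzD : ∀ y, (z, y) ∉ graphAccumulationSet f
    · simp only [g, if_neg hzC, if_pos hzD] at hz₂
      exact Or.inr ⟨hzD, hz₂⟩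
    · simp only [g, if_neg hzC, if_neg hzD] at hz₃
      exact absurd (hσT z (by simpa using hzD)) hz₃
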